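/- Let $X$ be a real Banach space with dual $X^*$. A continuous quadratic form on $X$ is a function $q\colon X\to\mathbb{R}$ of the form $q(x)=b(x,x)$ with $b\colon X\times X\to\mathbb{R}$ a continuous bilinear form. A function $X\to\mathbb{R}$ is delta-convex if it is the difference of two continuous convex functions $X\to\mathbb{R}$. A bounded linear operator $T\colon X\to X^*$ is symmetric if $\langle Tx,y\rangle=\langle Ty,x\rangle$ for all $x,y\in X$. For a real Banach space $E$, an $E$-valued Walsh–Paley martingale is a finite sequence $(f_0,\dots,f_n)$ of functions $f_k\colon\{-1,1\}^n\to E$ such that each $f_k$ depends only on the first $k$ coordinates and $$f_k(\omega)=\tfrac12 f_{k+1}(\omega,-1)+\tfrac12 f_{k+1}(\omega,1)\qquad(0\le k<n,\ \omega\in\{-1,1\}^k);$$ put $df_k=f_k-f_{k-1}$ for $1\le k\le n$, and let $\mathbb{E}$ denote the expectation with respect to the uniform probability measure on $\{-1,1\}^n$. A bounded linear operator $T\colon E\to F$ between real Banach spaces is a UMD-operator if there is a constant $C>0$ such that $$\mathbb{E}\Bigl\|\sum_{k=1}^n\varepsilon_k\,T\,df_k\Bigr\|^2\le C\,\mathbb{E}\|f_n\|^2$$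 for every $n$, every $E$-valued Walsh–Paley martingale $(f_0,\dots,f_n)$ and all numbers $\varepsilon_1,\dots,\varepsilon_n\in\{-1,1\}$. The space $E$ is a UMD-space if its identity operator is a UMD-operator. **Theorem.** Every continuous quadratic form on $X$ is delta-convex if and only if every symmetric bounded linear operator $T\colon X\to X^*$ is a UMD-operator. In particular, if $X$ is a UMD-space, then every continuous quadratic form on $X$ is delta-convex. -/

import Mathlib

/-- `q` is a continuous quadratic form on `X`: `q x = b (x, x)` for some continuous bilinear form
`b` (not required to be symmetric). -/
def IsContinuousQuadraticForm {X : Type*} [NormedAddCommGroup X] [NormedSpace ℝ X]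
    (q : X → ℝ) : Prop :=
  ∃ b : X →L[ℝ] X →L[ℝ] ℝ, ∀ x, q x = b x x

/-- `φ` is delta-convex: it is the difference of two continuous convex functions on `X`. -/
def IsDeltaConvex {X : Type*} [NormedAddCommGroup X] [NormedSpace ℝ X] (φ : X → ℝ) : Prop :=
  ∃ g h : X → ℝ, Continuous g ∧ ConvexOn ℝ Set.univ g ∧ Continuous h ∧ ConvexOn ℝ Set.univ h ∧
    ∀ x, φ x = g x - h x

/-- A bounded operator `T : X → X*` is symmetric if `⟨T x, y⟩ = ⟨T y, x⟩` for all `x, y`. -/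
def IsSymmetricToDual {X : Type*} [NormedAddCommGroup X] [NormedSpace ℝ X]
    (T : X →L[ℝ] StrongDual ℝ X) : Prop :=
  ∀ x y, T x y = T y x

/-- The sign cube `{-1, 1}ⁿ` (the units of `ℤ` are `1` and `-1`). -/
abbrev SignCube (n : ℕ) : Type := Fin n → ℤˣ

/-- The expectation of `g` for the uniform probability measure on `{-1, 1}ⁿ`. -/
noncomputable def signExpectation {n : ℕ} (g : SignCube n → ℝ) : ℝ :=
  (2 ^ n : ℝ)⁻¹ * ∑ η, g η

/-- `(f₀, …, fₙ)` is an `X`-valued Walsh-Paley martingale. The coordinates of `ω` are indexed from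
`0`, so the sign that is revealed between the times `k` and `k + 1` is `ω k`. -/
structure IsWalshPaleyMartingale {X : Type*} [NormedAddCommGroup X] [NormedSpace ℝ X] {n : ℕ}
    (f : Fin (n + 1) → SignCube n → X) : Prop where
  /-- `f k` depends only on the first `k` coordinates. -/
  adapted : ∀ (k : Fin (n + 1)) (ω ω' : SignCube n),
    (∀ i : Fin n, (i : ℕ) < (k : ℕ) → ω i = ω' i) → f k ω = f k ω'
  /-- `f k` is the average of `f (k + 1)` over the two values of the next sign. -/
  average : ∀ (k : Fin n) (ω : SignCube n),
    f k.castSucc ω = (1 / 2 : ℝ) • f k.succ (Function.update ω k (-1)) +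
      (1 / 2 : ℝ) • f k.succ (Function.update ω k 1)

/-- The bounded operator `T : X → Y` is a UMD-operator: there is `C > 0`, depending on `T` alone,
with `𝔼 ‖∑ₖ εₖ T dfₖ‖² ≤ C 𝔼 ‖fₙ‖²` for all `n`, all `X`-valued Walsh-Paley martingales
`(f₀, …, fₙ)` and all constant signs `ε₁, …, εₙ`. (For `n = 0` the inequality is trivial.) -/
def IsUMDOperator {X Y : Type*} [NormedAddCommGroup X] [NormedSpace ℝ X]
    [NormedAddCommGroup Y] [NormedSpace ℝ Y] (T : X →L[ℝ] Y) : Prop :=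
  ∃ C : ℝ, 0 < C ∧ ∀ (n : ℕ) (f : Fin (n + 1) → SignCube n → X), IsWalshPaleyMartingale f →
    ∀ ε : Fin n → ℝ, (∀ k, ε k = 1 ∨ ε k = -1) →
      signExpectation (fun η => ‖∑ k : Fin n, ε k • T (f k.succ η - f k.castSucc η)‖ ^ 2) ≤
        C * signExpectation (fun η => ‖f (Fin.last n) η‖ ^ 2)

/-- `X` is a UMD-space: the identity of `X` is a UMD-operator. -/
def IsUMDSpace (X : Type*) [NormedAddCommGroup X] [NormedSpace ℝ X] : Prop :=
  IsUMDOperator (ContinuousLinearMap.id ℝ X)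

/-! ### Averages over the sign cube. -/

section SignExpectation

/-! Both properties of a symmetric `T`, with `q x = T x x`, amount to a function `F` that controls
`q`. If `q = g - h` with `g`, `h` convex, the parallelogram law makes the midpoint gaps of `g` and
`h` differ by exactly `q d`, so `g + h` controls `q`. Conversely, if `F` controls `q` and is at most
quadratic, then `F + q` and `F` are convex and continuous, and `q = (F + q) - F`.

UMD gives control (`IsUMDOperator.exists_controls`): let `U x y` be the supremum of `𝔼 (‖y +
transform‖² - C ‖fₙ‖²)` over martingales started at `x`. It is midpoint concave along the steps `(d,
± T d)`, and the partial Legendre transform `F x = sup_y (y x - U x y / 2)` turns this into a gap of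
at least `|q d|`.

Control gives UMD: rescaling and homogenizing replace `F` by a `G` comparable to `‖x‖²`
(`Controls.exists_quadratic_growth`). A dual infimum of `G` is a function `H` that is midpoint
convex along the steps `(d, ± T d)` (`Controls.exists_bellman`), hence increases in mean along every
transform (`IsWalshPaleyMartingale.le_signExpectation`). The size bounds on `H` then give the UMD
inequality. -/

theorem signExpectation_add {n : ℕ} (g h : SignCube n → ℝ) :
    signExpectation (fun η => g η + h η) = signExpectation g + signExpectation h := by
  simp only [signExpectation, Finset.sum_add_distrib, mul_add]

theorem signExpectation_sub {n : ℕ} (g h : SignCube n → ℝ) :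
    signExpectation (fun η => g η - h η) = signExpectation g - signExpectation h := by
  simp only [signExpectation, Finset.sum_sub_distrib, mul_sub]

theorem signExpectation_const_mul {n : ℕ} (c : ℝ) (g : SignCube n → ℝ) :
    signExpectation (fun η => c * g η) = c * signExpectation g := by
  simp only [signExpectation, ← Finset.mul_sum]; ring

theorem signExpectation_const {n : ℕ} (c : ℝ) :
    signExpectation (fun _ : SignCube n => c) = c := by
  simp [signExpectation]

theorem signExpectation_mono {n : ℕ} {g h : SignCube n → ℝ} (H : ∀ η, g η ≤ h η) :
    signExpectation g ≤ signExpectation h :=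
  mul_le_mul_of_nonneg_left (Finset.sum_le_sum fun η _ => H η) (by positivity)

theorem signExpectation_cons {n : ℕ} (g : SignCube (n + 1) → ℝ) :
    signExpectation g = (signExpectation (fun η => g (Fin.cons 1 η)) +
      signExpectation (fun η => g (Fin.cons (-1) η))) / 2 := by
  have h : ∑ η, g η = ∑ p : ℤˣ × SignCube n, g (Fin.cons p.1 p.2) :=
    (Fintype.sum_equiv (Fin.consEquiv fun _ => ℤˣ) _ _ fun _ => rfl).symm
  have hu : (Finset.univ : Finset ℤˣ) = {1, -1} := rfl
  rw [signExpectation, h, Fintype.sum_prod_type, hu, Finset.sum_pair (by decide)]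
  simp only [signExpectation, pow_succ, mul_inv]
  ring

/-- Flipping one coordinate preserves the uniform measure. This replaces conditioning on the other
signs. -/
theorem signExpectation_update {n : ℕ} (k : Fin n) (g : SignCube n → ℝ) :
    signExpectation (fun ω => (g (Function.update ω k (-1)) + g (Function.update ω k 1)) / 2) =
      signExpectation g := by
  have hinv : Function.Involutive fun ω : SignCube n => Function.update ω k (-ω k) := by
    intro ω; simp
  have h : ∀ ω : SignCube n, (g (Function.update ω k (-1)) + g (Function.update ω k 1)) / 2 =
      (1 / 2) * g ω + (1 / 2) * g (Function.update ω k (-ω k)) := by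
    intro ω
    rcases Int.units_eq_one_or (ω k) with h | h
    · have : Function.update ω k 1 = ω := by rw [← h, Function.update_eq_self]
      rw [this, h]; ring
    · have : Function.update ω k (-1) = ω := by rw [← h, Function.update_eq_self]
      rw [this, h, neg_neg]; ring
  simp only [h, signExpectation_add, signExpectation_const_mul]
  have : signExpectation (fun ω => g (Function.update ω k (-ω k))) = signExpectation g := by
    unfold signExpectation
    congr 1
    exact Fintype.sum_equiv hinv.toPerm _ _ fun _ => rfl
  rw [this]; ring

end SignExpectation

/-! ### Control functions and convexity. -/

section Control

variable {X : Type*} [NormedAddCommGroup X] [NormedSpace ℝ X]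

/-- `F` controls `q`: the midpoint convexity gap of `F` dominates `|q|`. -/
def Controls (F q : X → ℝ) : Prop :=
  ∀ x d, F x + |q d| ≤ (F (x + d) + F (x - d)) / 2

theorem convexOn_univ_of_midpoint {F : X → ℝ} {K : ℝ} (hK : ∀ x, F x ≤ K * ‖x‖ ^ 2)
    (hF : ∀ x d, F x ≤ (F (x + d) + F (x - d)) / 2) : ConvexOn ℝ Set.univ F := by
  refine ⟨convex_univ, fun x _ y _ => ?_⟩
  set ψ : ℝ → ℝ := fun t => F ((1 - t) • x + t • y) - ((1 - t) * F x + t * F y) with hψ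
  have hmid : ∀ s t, ψ ((s + t) / 2) ≤ (ψ s + ψ t) / 2 := by
    intro s t
    have h := hF ((1 - (s + t) / 2) • x + ((s + t) / 2) • y) (((s - t) / 2) • (y - x))
    have e1 : (1 - (s + t) / 2) • x + ((s + t) / 2) • y + ((s - t) / 2) • (y - x) =
      (1 - s) • x + s • y := by module
    have e2 : (1 - (s + t) / 2) • x + ((s + t) / 2) • y - ((s - t) / 2) • (y - x) =
      (1 - t) • x + t • y := by module
    rw [e1, e2] at h
    simp only [hψ]
    linarith
  have h0 : ψ 0 = 0 := by simp [hψ]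
  have h1 : ψ 1 = 0 := by simp [hψ]
  obtain ⟨B, hB0, hB⟩ : ∃ B, 0 ≤ B ∧ ∀ t, 0 ≤ t → t ≤ 1 → ψ t ≤ B := by
    refine ⟨|K| * (‖x‖ + ‖y‖) ^ 2 + |F x| + |F y|, by positivity, fun t ht0 ht1 => ?_⟩
    have a1 : ‖(1 - t) • x + t • y‖ ≤ ‖x‖ + ‖y‖ := by
      refine (norm_add_le _ _).trans ?_
      rw [norm_smul, norm_smul, Real.norm_of_nonneg ht0, Real.norm_of_nonneg (sub_nonneg.2 ht1)]
      nlinarith [norm_nonneg x, norm_nonneg y]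
    have a2 : F ((1 - t) • x + t • y) ≤ |K| * (‖x‖ + ‖y‖) ^ 2 :=
      (hK _).trans (mul_le_mul (le_abs_self K) (pow_le_pow_left₀ (norm_nonneg _) a1 2)
        (by positivity) (abs_nonneg _))
    simp only [hψ]
    nlinarith [neg_abs_le (F x), neg_abs_le (F y), abs_nonneg (F x), abs_nonneg (F y)]
  -- Every `t` in `[0, 1]` is the midpoint of an endpoint, where `ψ` vanishes, and another point of
  -- `[0, 1]`; each use of this halves the bound.
  have hpow : ∀ n : ℕ, ∀ t, 0 ≤ t → t ≤ 1 → ψ t ≤ (1 / 2) ^ n * B := by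
    intro n
    induction n with
    | zero => simpa using hB
    | succ n ih =>
      intro t ht0 ht1
      rcases le_total t (1 / 2) with h | h
      · have := hmid (2 * t) 0
        rw [show (2 * t + 0) / 2 = t by ring, h0] at this
        have := ih (2 * t) (by linarith) (by linarith)
        rw [pow_succ]; linarith
      · have := hmid (2 * t - 1) 1
        rw [show (2 * t - 1 + 1) / 2 = t by ring, h1] at this
        have := ih (2 * t - 1) (by linarith) (by linarith)
        rw [pow_succ]; linarith
  intro a b ha hb hab
  have hlim : Filter.Tendsto (fun n : ℕ => (1 / 2 : ℝ) ^ n * B) Filter.atTop (nhds 0) := by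
    simpa using (tendsto_pow_atTop_nhds_zero_of_lt_one (by norm_num : (0 : ℝ) ≤ 1 / 2)
      (by norm_num)).mul_const B
  have := ge_of_tendsto' hlim fun n => hpow n b hb (by linarith)
  obtain rfl : a = 1 - b := by linarith
  simp only [hψ] at this
  simpa using this

theorem continuous_of_convexOn_univ {F : X → ℝ} {K : ℝ} (hK : ∀ x, F x ≤ K * ‖x‖ ^ 2)
    (hF : ConvexOn ℝ Set.univ F) : Continuous F := by
  rw [← continuousOn_univ]
  refine ((hF.continuousOn_tfae isOpen_univ Set.univ_nonempty).out 1 3).2 ?_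
  refine ⟨0, trivial, Filter.isBoundedUnder_of_eventually_le (a := |K| * 1) ?_⟩
  filter_upwards [Metric.ball_mem_nhds (0 : X) one_pos] with x hx
  rw [mem_ball_zero_iff] at hx
  exact (hK x).trans (mul_le_mul (le_abs_self K) (pow_le_one₀ (norm_nonneg _) hx.le)
    (by positivity) (abs_nonneg _))

theorem IsSymmetricToDual.apply_add {T : X →L[ℝ] StrongDual ℝ X} (hT : IsSymmetricToDual T)
    (x d : X) : T (x + d) (x + d) = T x x + 2 * T x d + T d d := by
  simp only [map_add, add_apply, hT d x]; ring

theorem IsSymmetricToDual.apply_sub {T : X →L[ℝ] StrongDual ℝ X} (hT : IsSymmetricToDual T)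
    (x d : X) : T (x - d) (x - d) = T x x - 2 * T x d + T d d := by
  simp only [map_sub, sub_apply, hT d x]; ring

theorem abs_apply_self_le (T : X →L[ℝ] StrongDual ℝ X) (x : X) :
    |T x x| ≤ ‖T‖ * ‖x‖ ^ 2 := by
  have := T.le_opNorm₂ x x
  rwa [Real.norm_eq_abs, mul_assoc, ← pow_two] at this

theorem Controls.isDeltaConvex {T : X →L[ℝ] StrongDual ℝ X} (hT : IsSymmetricToDual T)
    {F : X → ℝ} {K : ℝ} (hK : ∀ x, F x ≤ K * ‖x‖ ^ 2) (hF : Controls F fun x => T x x) :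
    IsDeltaConvex fun x => T x x := by
  have hF' : ∀ x d, F x ≤ (F (x + d) + F (x - d)) / 2 := fun x d =>
    (le_add_of_nonneg_right (abs_nonneg _)).trans (hF x d)
  have hG : ∀ x d, F x + T x x ≤
      (F (x + d) + T (x + d) (x + d) + (F (x - d) + T (x - d) (x - d))) / 2 := by
    intro x d
    rw [IsSymmetricToDual.apply_add hT, IsSymmetricToDual.apply_sub hT]
    linarith [hF x d, neg_abs_le (T d d)]
  have hKG : ∀ x, F x + T x x ≤ (K + ‖T‖) * ‖x‖ ^ 2 := by
    intro x
    linarith [hK x, abs_apply_self_le T x, le_abs_self (T x x)]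
  have cG := convexOn_univ_of_midpoint hKG hG
  have cF := convexOn_univ_of_midpoint hK hF'
  exact ⟨fun x => F x + T x x, F, continuous_of_convexOn_univ hKG cG, cG,
    continuous_of_convexOn_univ hK cF, cF, fun x => by ring⟩

end Control

/-! ### From the UMD inequality to a control function. -/

section UMDToControl

variable {X Y : Type*} [NormedAddCommGroup X] [NormedSpace ℝ X]
  [NormedAddCommGroup Y] [NormedSpace ℝ Y]

/-- The process that jumps from `x` to the initial value of `g` or `h`, according to the first
sign, and then follows `g` or `h`. -/
def branchProcess {n : ℕ} (x : X) (g h : Fin (n + 1) → SignCube n → X) :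
    Fin (n + 2) → SignCube (n + 1) → X :=
  fun k ω => Fin.cases (motive := fun _ => X) x
    (fun j => (if ω 0 = 1 then g else h) j (Fin.tail ω)) k

theorem IsWalshPaleyMartingale.branch {n : ℕ} {x d : X} {g h : Fin (n + 1) → SignCube n → X}
    (hg : IsWalshPaleyMartingale g) (hh : IsWalshPaleyMartingale h)
    (hg0 : ∀ η, g 0 η = x + d) (hh0 : ∀ η, h 0 η = x - d) :
    IsWalshPaleyMartingale (branchProcess x g h) where
  adapted k ω ω' H := by
    induction k using Fin.cases with
    | zero => rfl
    | succ j =>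
      have h0 : ω 0 = ω' 0 := H 0 (by simp)
      have ht : ∀ i : Fin n, (i : ℕ) < j → Fin.tail ω i = Fin.tail ω' i := fun i hi =>
        H i.succ (by simpa using hi)
      simp only [branchProcess, Fin.cases_succ, h0]
      split_ifs
      · exact hg.adapted j _ _ ht
      · exact hh.adapted j _ _ ht
  average k ω := by
    induction k using Fin.cases with
    | zero =>
      simp only [branchProcess, Fin.castSucc_zero, Fin.cases_zero, Fin.cases_succ,
        Function.update_self]
      simp only [if_true, reduceIte, show ¬ ((-1 : ℤˣ) = 1) by decide, hg0, hh0]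
      module
    | succ j =>
      have e : ∀ u : ℤˣ, Function.update ω j.succ u 0 = ω 0 := fun u =>
        Function.update_of_ne (Fin.succ_ne_zero j).symm _ _
      simp only [branchProcess, ← Fin.succ_castSucc, Fin.cases_succ, Fin.tail_update_succ, e]
      split_ifs
      · exact hg.average j _
      · exact hh.average j _

/-- The final value of the transform of `f` by alternating signs that end in `-1`. -/
noncomputable def alternatingTransform (T : X →L[ℝ] Y) {n : ℕ} (f : Fin (n + 1) → SignCube n → X)
    (η : SignCube n) : Y :=
  ∑ k : Fin n, (-1 : ℝ) ^ (n - (k : ℕ)) • T (f k.succ η - f k.castSucc η)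

/-- The sign of a step depends only on the number of steps that remain, so a step put in front
leaves the later signs unchanged, and both branches share them. -/
theorem alternatingTransform_branch (T : X →L[ℝ] Y) {n : ℕ} {x d : X}
    {g h : Fin (n + 1) → SignCube n → X}
    (hg0 : ∀ η, g 0 η = x + d) (hh0 : ∀ η, h 0 η = x - d) (η : SignCube n) :
    alternatingTransform T (branchProcess x g h) (Fin.cons 1 η) =
        (-1 : ℝ) ^ (n + 1) • T d + alternatingTransform T g η ∧
      alternatingTransform T (branchProcess x g h) (Fin.cons (-1) η) =
        -((-1 : ℝ) ^ (n + 1) • T d) + alternatingTransform T h η := by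
  constructor
  · simp only [alternatingTransform, Fin.sum_univ_succ (n := n), branchProcess, Fin.cons_zero,
      Fin.tail_cons, Fin.castSucc_zero, Fin.cases_zero, Fin.cases_succ, ← Fin.succ_castSucc]
    simp [hg0]
  · have : ¬ ((-1 : ℤˣ) = 1) := by decide
    simp only [alternatingTransform, Fin.sum_univ_succ (n := n), branchProcess, Fin.cons_zero,
      Fin.tail_cons, Fin.castSucc_zero, Fin.cases_zero, Fin.cases_succ, ← Fin.succ_castSucc,
      if_neg this]
    simp [hh0, sub_eq_add_neg x d]

/-- The values `𝔼 (‖y + ∑ₖ ± T dfₖ‖² - C ‖fₙ‖²)` with alternating signs, over all Walsh-Paley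
martingales of length `n` that start at `x`. -/
def transformValues (T : X →L[ℝ] Y) (C : ℝ) (n : ℕ) (x : X) (y : Y) : Set ℝ :=
  {v | ∃ f : Fin (n + 1) → SignCube n → X, IsWalshPaleyMartingale f ∧ (∀ η, f 0 η = x) ∧
    v = signExpectation fun η =>
      ‖y + alternatingTransform T f η‖ ^ 2 - C * ‖f (Fin.last n) η‖ ^ 2}

theorem mem_transformValues_zero (T : X →L[ℝ] Y) (C : ℝ) (x : X) (y : Y) :
    ‖y‖ ^ 2 - C * ‖x‖ ^ 2 ∈ transformValues T C 0 x y := by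
  refine ⟨fun _ _ => x, ⟨fun _ _ _ _ => rfl, fun k => k.elim0⟩, fun _ => rfl, ?_⟩
  simp [alternatingTransform, signExpectation_const]

theorem mem_transformValues_succ {T : X →L[ℝ] Y} {C : ℝ} {n : ℕ} {x d : X} {y : Y} {a b : ℝ}
    (ha : a ∈ transformValues T C n (x + d) (y + (-1 : ℝ) ^ (n + 1) • T d))
    (hb : b ∈ transformValues T C n (x - d) (y - (-1 : ℝ) ^ (n + 1) • T d)) :
    (a + b) / 2 ∈ transformValues T C (n + 1) x y := by
  obtain ⟨g, hg, hg0, rfl⟩ := ha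
  obtain ⟨h, hh, hh0, rfl⟩ := hb
  refine ⟨branchProcess x g h, hg.branch hh hg0 hh0, fun η => rfl, ?_⟩
  rw [signExpectation_cons]
  have hne : ¬ ((-1 : ℤˣ) = 1) := by decide
  have e1 : ∀ η, branchProcess x g h (Fin.last (n + 1)) (Fin.cons 1 η) = g (Fin.last n) η := by
    intro η
    simp [branchProcess, ← Fin.succ_last]
  have e2 : ∀ η, branchProcess x g h (Fin.last (n + 1)) (Fin.cons (-1) η) =
      h (Fin.last n) η := by
    intro η
    simp [branchProcess, ← Fin.succ_last, hne]
  simp only [e1, e2, (alternatingTransform_branch T hg0 hh0 _).1,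
    (alternatingTransform_branch T hg0 hh0 _).2, sub_eq_add_neg y, add_assoc]

/-- A step with `d = 0` may be put in front of a martingale without changing its value. -/
theorem transformValues_monotone (T : X →L[ℝ] Y) (C : ℝ) (x : X) (y : Y) :
    Monotone fun n => transformValues T C n x y := by
  refine monotone_nat_of_le_succ fun n v hv => ?_
  have := mem_transformValues_succ (d := 0) (a := v) (b := v) (n := n) (T := T) (C := C) (x := x)
    (y := y) (by simpa using hv) (by simpa using hv)
  simpa using this

def allTransformValues (T : X →L[ℝ] Y) (C : ℝ) (x : X) (y : Y) : Set ℝ :=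
  ⋃ n, transformValues T C n x y

theorem mem_allTransformValues (T : X →L[ℝ] Y) (C : ℝ) (x : X) (y : Y) :
    ‖y‖ ^ 2 - C * ‖x‖ ^ 2 ∈ allTransformValues T C x y :=
  Set.mem_iUnion.2 ⟨0, mem_transformValues_zero T C x y⟩

theorem average_mem_allTransformValues {T : X →L[ℝ] Y} {C : ℝ} {x d : X} {y : Y} {a b σ : ℝ}
    (hσ : σ = 1 ∨ σ = -1) (ha : a ∈ allTransformValues T C (x + d) (y + σ • T d))
    (hb : b ∈ allTransformValues T C (x - d) (y - σ • T d)) :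
    (a + b) / 2 ∈ allTransformValues T C x y := by
  obtain ⟨m, hm⟩ := Set.mem_iUnion.1 ha
  obtain ⟨k, hk⟩ := Set.mem_iUnion.1 hb
  -- Padding brings both branches to a common length, whose parity is chosen so that the step in
  -- front carries the sign `σ`.
  obtain ⟨n, hmn, hkn, hn⟩ : ∃ n, m ≤ n ∧ k ≤ n ∧ (-1 : ℝ) ^ (n + 1) = σ := by
    rcases hσ with rfl | rfl
    · exact ⟨2 * (m + k) + 1, by omega, by omega, Even.neg_one_pow ⟨m + k + 1, by ring⟩⟩
    · exact ⟨2 * (m + k), by omega, by omega, Odd.neg_one_pow ⟨m + k, rfl⟩⟩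
  have ha' := transformValues_monotone T C _ _ hmn hm
  have hb' := transformValues_monotone T C _ _ hkn hk
  rw [← hn] at ha' hb'
  exact Set.mem_iUnion.2 ⟨n + 1, mem_transformValues_succ ha' hb'⟩

theorem IsUMDOperator.exists_allTransformValues_nonpos {T : X →L[ℝ] Y} (hT : IsUMDOperator T) :
    ∃ C, 0 < C ∧ ∀ x, ∀ v ∈ allTransformValues T C x 0, v ≤ 0 := by
  obtain ⟨C, hC, H⟩ := hT
  refine ⟨C, hC, fun x v hv => ?_⟩
  obtain ⟨n, f, hf, -, rfl⟩ := Set.mem_iUnion.1 hv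
  have := H n f hf (fun k => (-1 : ℝ) ^ (n - (k : ℕ))) fun k => neg_one_pow_eq_or ℝ _
  simp only [zero_add, alternatingTransform]
  rw [signExpectation_sub, signExpectation_const_mul]
  linarith

/-- A control function from the Bellman function of the UMD inequality. -/
theorem IsUMDOperator.exists_controls {T : X →L[ℝ] StrongDual ℝ X} (hT : IsUMDOperator T) :
    ∃ (F : X → ℝ) (K : ℝ), (∀ x, F x ≤ K * ‖x‖ ^ 2) ∧ Controls F fun x => T x x := by
  obtain ⟨C, -, H⟩ := hT.exists_allTransformValues_nonpos
  set A := allTransformValues T C with hA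
  have hne : ∀ x y, (A x y).Nonempty := fun x y => ⟨_, mem_allTransformValues T C x y⟩
  -- Boundedness is required because the `sSup` of an unbounded set of reals is `0`. The UMD
  -- inequality ensures that `y = 0` qualifies.
  set S : X → Set ℝ := fun x =>
    {v | ∃ y : StrongDual ℝ X, BddAbove (A x y) ∧ v = y x - sSup (A x y) / 2} with hS
  have hSne : ∀ x, (S x).Nonempty := fun x => ⟨_, 0, ⟨0, fun v hv => H x v hv⟩, rfl⟩
  have hSle : ∀ x, ∀ v ∈ S x, v ≤ (C + 1) / 2 * ‖x‖ ^ 2 := by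
    rintro x v ⟨y, hy, rfl⟩
    have h1 := le_csSup hy (mem_allTransformValues T C x y)
    have h2 : y x ≤ ‖y‖ * ‖x‖ := (le_abs_self _).trans (y.le_opNorm x)
    nlinarith [sq_nonneg (‖y‖ - ‖x‖)]
  have hSb : ∀ x, BddAbove (S x) := fun x => ⟨_, hSle x⟩
  refine ⟨fun x => sSup (S x), (C + 1) / 2, fun x => csSup_le (hSne x) (hSle x), fun x d => ?_⟩
  -- The gain comes from `(y + σ T d)(x + d) + (y - σ T d)(x - d) = 2 y x + 2 σ T d d`.
  obtain ⟨σ, hσ, hσd⟩ : ∃ σ : ℝ, (σ = 1 ∨ σ = -1) ∧ |T d d| = σ * T d d := by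
    rcases le_total 0 (T d d) with h | h
    · exact ⟨1, Or.inl rfl, by rw [abs_of_nonneg h, one_mul]⟩
    · exact ⟨-1, Or.inr rfl, by rw [abs_of_nonpos h, neg_one_mul]⟩
  rw [← le_sub_iff_add_le]
  refine csSup_le (hSne x) ?_
  rintro v ⟨y, hy, rfl⟩
  have key : ∀ a ∈ A (x + d) (y + σ • T d), ∀ b ∈ A (x - d) (y - σ • T d),
      (a + b) / 2 ≤ sSup (A x y) := fun a ha b hb =>
    le_csSup hy (average_mem_allTransformValues hσ ha hb)
  -- Fixing one value on one branch bounds the values on the other, so both shifted functionals are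
  -- admissible.
  obtain ⟨a₀, ha₀⟩ := hne (x + d) (y + σ • T d)
  obtain ⟨b₀, hb₀⟩ := hne (x - d) (y - σ • T d)
  have hp : BddAbove (A (x + d) (y + σ • T d)) :=
    ⟨2 * sSup (A x y) - b₀, fun a ha => by linarith [key a ha b₀ hb₀]⟩
  have hm : BddAbove (A (x - d) (y - σ • T d)) :=
    ⟨2 * sSup (A x y) - a₀, fun b hb => by linarith [key a₀ ha₀ b hb]⟩
  have hsum : sSup (A (x + d) (y + σ • T d)) ≤
      2 * sSup (A x y) - sSup (A (x - d) (y - σ • T d)) := by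
    refine csSup_le (hne _ _) fun a ha => ?_
    have : sSup (A (x - d) (y - σ • T d)) ≤ 2 * sSup (A x y) - a :=
      csSup_le (hne _ _) fun b hb => by linarith [key a ha b hb]
    linarith
  have h1 := le_csSup (hSb (x + d)) ⟨y + σ • T d, hp, rfl⟩
  have h2 := le_csSup (hSb (x - d)) ⟨y - σ • T d, hm, rfl⟩
  simp only [add_apply, sub_apply, smul_apply, smul_eq_mul, map_add, map_sub] at h1 h2
  rw [hσd]
  linarith

end UMDToControl

/-! ### From delta-convexity to a Bellman function. -/

section ControlToUMD

variable {X : Type*} [NormedAddCommGroup X] [NormedSpace ℝ X]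

/-- The values whose supremum is the homogenization of `F` at `x`. -/
def homogenizedValues (F : X → ℝ) (K : ℝ) (x : X) : Set ℝ :=
  {v | ∃ s : ℝ, 0 < s ∧ ‖x‖ < 8 * s ∧
    v = s ^ 2 * F (s⁻¹ • x) + K * (2 * s * ‖x‖ - s ^ 2)}

theorem norm_inv_smul_lt {x : X} {s : ℝ} (hs : 0 < s) (hx : ‖x‖ < 8 * s) : ‖s⁻¹ • x‖ < 8 := by
  rw [norm_smul, norm_inv, Real.norm_of_nonneg hs.le, inv_mul_lt_iff₀ hs]
  linarith

/-- A control function of a quadratic form that is bounded on a ball yields one of quadratic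
growth. -/
theorem Controls.exists_quadratic_growth {T : X →L[ℝ] StrongDual ℝ X} {F : X → ℝ} {M : ℝ}
    (hF : Controls F fun x => T x x) (h0 : ∀ x, ‖x‖ < 8 → 0 ≤ F x)
    (hM : ∀ x, ‖x‖ < 8 → F x ≤ M) :
    ∃ (G : X → ℝ) (K : ℝ), 0 < K ∧ (∀ x, K * ‖x‖ ^ 2 ≤ G x) ∧ (∀ x, G x ≤ 2 * K * ‖x‖ ^ 2) ∧
      Controls G fun x => T x x := by
  have hM0 : 0 ≤ M := (h0 0 (by simp)).trans (hM 0 (by simp))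
  -- `2 * M ≤ K` lets half of `K s²` absorb `s² F`; `2 * ‖T‖ ≤ K` serves for large `d`.
  obtain ⟨K, hK, hKM, hKT⟩ : ∃ K : ℝ, 0 < K ∧ 2 * M ≤ K ∧ 2 * ‖T‖ ≤ K :=
    ⟨2 * M + 2 * ‖T‖ + 1, by positivity, by linarith [norm_nonneg T], by linarith⟩
  set S := homogenizedValues F K with hS
  have hle : ∀ x s, 0 < s → ‖x‖ < 8 * s →
      s ^ 2 * F (s⁻¹ • x) + K * (2 * s * ‖x‖ - s ^ 2) ≤ K * (2 * s * ‖x‖ - s ^ 2 / 2) := by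
    intro x s hs hx
    nlinarith [hM _ (norm_inv_smul_lt hs hx), sq_nonneg s]
  have hub : ∀ x, ∀ v ∈ S x, v ≤ 2 * K * ‖x‖ ^ 2 := by
    rintro x v ⟨s, hs, hx, rfl⟩
    refine (hle x s hs hx).trans ?_
    nlinarith [sq_nonneg (s - 2 * ‖x‖)]
  have hbdd : ∀ x, BddAbove (S x) := fun x => ⟨_, hub x⟩
  have hne : ∀ x, (S x).Nonempty := fun x =>
    ⟨_, ‖x‖ + 1, by positivity, by linarith [norm_nonneg x], rfl⟩
  have hmem : ∀ x s, 0 < s → ‖x‖ < 8 * s →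
      s ^ 2 * F (s⁻¹ • x) + K * (2 * s * ‖x‖ - s ^ 2) ≤ sSup (S x) := fun x s hs hx =>
    le_csSup (hbdd x) ⟨s, hs, hx, rfl⟩
  have hG2 : ∀ x, sSup (S x) ≤ 2 * K * ‖x‖ ^ 2 := fun x => csSup_le (hne x) (hub x)
  have hG1 : ∀ x, K * ‖x‖ ^ 2 ≤ sSup (S x) := by
    intro x
    rcases eq_or_ne x 0 with rfl | hx
    · have : ∀ s : ℝ, 0 < s → -(K * s ^ 2) ≤ sSup (S 0) := by
        intro s hs
        have h := hmem 0 s hs (by simpa using hs)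
        have := h0 (s⁻¹ • (0 : X)) (by simp)
        simp only [norm_zero] at h
        nlinarith [mul_nonneg (sq_nonneg s) this]
      have hlim : Filter.Tendsto (fun s : ℝ => -(K * s ^ 2)) (nhdsWithin 0 (Set.Ioi 0))
          (nhds (-(K * 0 ^ 2))) :=
        (Continuous.tendsto (by fun_prop) 0).mono_left nhdsWithin_le_nhds
      have := le_of_tendsto hlim (Filter.eventually_of_mem self_mem_nhdsWithin this)
      simpa using this
    · have hx' := norm_pos_iff.2 hx
      have h := hmem x ‖x‖ hx' (by linarith)
      have := h0 (‖x‖⁻¹ • x) (norm_inv_smul_lt hx' (by linarith))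
      nlinarith [mul_nonneg (sq_nonneg ‖x‖) this]
  refine ⟨fun x => sSup (S x), K, hK, hG1, hG2, fun x d => ?_⟩
  have hdd := abs_apply_self_le T d
  -- For large `d` the two growth bounds suffice. For small `d` one scale `s`, nearly optimal at
  -- `x`, is used at all three points.
  rcases le_or_gt (2 * ‖x‖) ‖d‖ with hd | hd
  · have hd2 : ‖d‖ ≤ (‖x + d‖ + ‖x - d‖) / 2 := by
      have : (2 : ℝ) • d = (x + d) - (x - d) := by module
      have h := norm_sub_le (x + d) (x - d)
      rw [← this, norm_smul, Real.norm_of_nonneg zero_le_two] at h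
      linarith
    have hsq : 2 * ‖d‖ ^ 2 ≤ ‖x + d‖ ^ 2 + ‖x - d‖ ^ 2 := by
      nlinarith [sq_nonneg (‖x + d‖ - ‖x - d‖), norm_nonneg d]
    have hxd : 4 * ‖x‖ ^ 2 ≤ ‖d‖ ^ 2 := by nlinarith [norm_nonneg x]
    have := hG1 (x + d)
    have := hG1 (x - d)
    have := hG2 x
    simp only
    nlinarith [sq_nonneg ‖d‖, mul_le_mul_of_nonneg_left hsq hK.le,
      mul_le_mul_of_nonneg_left hxd hK.le, mul_le_mul_of_nonneg_right hKT (sq_nonneg ‖d‖)]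
  · have hx : 0 < ‖x‖ := by linarith [norm_nonneg d, norm_nonneg x]
    simp only
    refine le_of_forall_pos_lt_add fun ε hε => ?_
    obtain ⟨v, ⟨s, hs, hxs, rfl⟩, hv⟩ := exists_lt_of_lt_csSup (hne x)
      (show sSup (S x) - min ε (K * ‖x‖ ^ 2 / 8) < sSup (S x) from
        sub_lt_self _ (lt_min hε (by positivity)))
    have hv1 := min_le_left ε (K * ‖x‖ ^ 2 / 8)
    have hv2 := min_le_right ε (K * ‖x‖ ^ 2 / 8)
    -- A scale `s ≤ ‖x‖ / 2` yields at most `7/8 K ‖x‖²`, too little by the choice of the tolerance.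
    -- Hence `‖x ± d‖ < 3 ‖x‖ < 8 s`, and `s` is admissible at `x ± d`.
    have hs2 : ‖x‖ / 2 < s := by
      by_contra! hcon
      have h1 := hle x s hs hxs
      have h2 := hG1 x
      have h3 : 2 * s * ‖x‖ - s ^ 2 / 2 ≤ 7 / 8 * ‖x‖ ^ 2 := by nlinarith
      nlinarith [mul_le_mul_of_nonneg_left h3 hK.le]
    have hp := hmem (x + d) s hs (by linarith [norm_add_le x d])
    have hm := hmem (x - d) s hs (by linarith [norm_sub_le x d])
    have hc := hF (s⁻¹ • x) (s⁻¹ • d)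
    rw [← smul_add, ← smul_sub] at hc
    have hq : s ^ 2 * |T (s⁻¹ • d) (s⁻¹ • d)| = |T d d| := by
      simp only [map_smul, smul_apply, smul_eq_mul, abs_mul, abs_inv, abs_of_pos hs]
      field_simp
    have hc' := mul_le_mul_of_nonneg_left hc (sq_nonneg s)
    simp only [mul_add, hq] at hc'
    have hnorm : 2 * ‖x‖ ≤ ‖x + d‖ + ‖x - d‖ := by
      have : (2 : ℝ) • x = (x + d) + (x - d) := by module
      have h := norm_add_le (x + d) (x - d)
      rwa [← this, norm_smul, Real.norm_of_nonneg zero_le_two] at h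
    have hn' := mul_le_mul_of_nonneg_left hnorm (mul_pos hK hs).le
    linarith

/-- Continuity at `0` bounds `g + h` on a small ball only. As `q` is 2-homogeneous, `x ↦ c⁻² (g + h)
(c x)` still controls `q`, and a constant makes it nonnegative on the ball of radius `8`. -/
theorem IsDeltaConvex.exists_controls {T : X →L[ℝ] StrongDual ℝ X} (hT : IsSymmetricToDual T)
    (h : IsDeltaConvex fun x => T x x) :
    ∃ (F : X → ℝ) (M : ℝ), Controls F (fun x => T x x) ∧ (∀ x, ‖x‖ < 8 → 0 ≤ F x) ∧
      ∀ x, ‖x‖ < 8 → F x ≤ M := by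
  obtain ⟨g, h, hgc, hg, hhc, hh, hq⟩ := h
  have mid : ∀ {φ : X → ℝ}, ConvexOn ℝ Set.univ φ → ∀ x d,
      φ x ≤ (φ (x + d) + φ (x - d)) / 2 := by
    intro φ hφ x d
    have := hφ.2 (Set.mem_univ (x + d)) (Set.mem_univ (x - d))
      (by norm_num : (0 : ℝ) ≤ 1 / 2) (by norm_num : (0 : ℝ) ≤ 1 / 2) (by norm_num)
    rw [show (1 / 2 : ℝ) • (x + d) + (1 / 2 : ℝ) • (x - d) = x by module] at this
    simp only [smul_eq_mul] at this
    linarith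
  have hcont : Continuous fun x => g x + h x := hgc.add hhc
  have hctrl : Controls (fun x => g x + h x) fun x => T x x := by
    intro x d
    have e1 := hq x
    have e2 := hq (x + d)
    have e3 := hq (x - d)
    beta_reduce at e1 e2 e3 ⊢
    rw [IsSymmetricToDual.apply_add hT] at e2
    rw [IsSymmetricToDual.apply_sub hT] at e3
    have := mid hg x d
    have := mid hh x d
    rcases abs_cases (T d d) with ⟨h, -⟩ | ⟨h, -⟩ <;> rw [h] <;> linarith
  obtain ⟨r, hr, hball⟩ := Metric.continuousAt_iff.1 (hcont.continuousAt (x := 0)) 1 one_pos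
  simp only [dist_zero_right, Real.dist_eq, abs_lt] at hball
  set c := r / 8 with hc
  have hc0 : 0 < c := by positivity
  have hcx : ∀ x : X, ‖x‖ < 8 → ‖c • x‖ < r := by
    intro x hx
    rw [norm_smul, Real.norm_of_nonneg hc0.le]
    calc c * ‖x‖ < c * 8 := mul_lt_mul_of_pos_left hx hc0
      _ = r := by rw [hc]; ring
  refine ⟨fun x => (c ^ 2)⁻¹ * (g (c • x) + h (c • x) - (g 0 + h 0) + 1), (c ^ 2)⁻¹ * 2,
    fun x d => ?_, fun x hx => ?_, fun x hx => ?_⟩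
  · have hd := hctrl (c • x) (c • d)
    rw [← smul_add, ← smul_sub] at hd
    have hq : |T d d| = (c ^ 2)⁻¹ * |T (c • d) (c • d)| := by
      simp only [map_smul, smul_apply, smul_eq_mul, abs_mul, abs_of_pos hc0]
      field_simp
    simp only at hd ⊢
    rw [hq]
    have := mul_le_mul_of_nonneg_left hd (by positivity : 0 ≤ (c ^ 2)⁻¹)
    linarith
  · have := (hball (hcx x hx)).1
    exact mul_nonneg (by positivity) (by linarith)
  · have := (hball (hcx x hx)).2
    exact mul_le_mul_of_nonneg_left (by linarith) (by positivity)

/-- A Bellman function for the UMD inequality, from a control function of quadratic growth. -/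
theorem Controls.exists_bellman {T : X →L[ℝ] StrongDual ℝ X} (hT : IsSymmetricToDual T)
    {G : X → ℝ} {K : ℝ} (hK : 0 < K) (hG1 : ∀ x, K * ‖x‖ ^ 2 ≤ G x)
    (hG2 : ∀ x, G x ≤ 2 * K * ‖x‖ ^ 2) (hG : Controls G fun x => T x x) :
    ∃ H : X → StrongDual ℝ X → ℝ, (∀ x, 0 ≤ H x 0) ∧
      (∀ x z, H x z ≤ 2 * K * ‖x‖ ^ 2 - (8 * K)⁻¹ * ‖z‖ ^ 2) ∧
      ∀ x z d, ∀ σ : ℝ, (σ = 1 ∨ σ = -1) →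
        H x z ≤ (H (x + d) (z + σ • T d) + H (x - d) (z - σ • T d)) / 2 := by
  set P : X → StrongDual ℝ X → X → ℝ := fun x z y => (G (x + y) + G (x - y)) / 4 - z y with hP
  have hPlow : ∀ x z y, K / 2 * ‖y‖ ^ 2 - z y ≤ P x z y := by
    intro x z y
    have : (2 : ℝ) • y = (x + y) - (x - y) := by module
    have h := norm_sub_le (x + y) (x - y)
    rw [← this, norm_smul, Real.norm_of_nonneg zero_le_two] at h
    have hsq : 2 * ‖y‖ ^ 2 ≤ ‖x + y‖ ^ 2 + ‖x - y‖ ^ 2 := by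
      nlinarith [sq_nonneg (‖x + y‖ - ‖x - y‖), norm_nonneg y]
    simp only [hP]
    linarith [hG1 (x + y), hG1 (x - y), mul_le_mul_of_nonneg_left hsq hK.le]
  have hbdd : ∀ x z, BddBelow (Set.range (P x z)) := by
    intro x z
    refine ⟨-(‖z‖ ^ 2 / (2 * K)), ?_⟩
    rintro _ ⟨y, rfl⟩
    refine le_trans ?_ (hPlow x z y)
    have h1 : z y ≤ ‖z‖ * ‖y‖ := (le_abs_self _).trans (z.le_opNorm y)
    have h2 : 0 ≤ (K * ‖y‖ - ‖z‖) ^ 2 / (2 * K) := by positivity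
    have h3 : (K * ‖y‖ - ‖z‖) ^ 2 / (2 * K) =
        K / 2 * ‖y‖ ^ 2 - ‖z‖ * ‖y‖ + ‖z‖ ^ 2 / (2 * K) := by
      field_simp; ring
    linarith
  have hPup : ∀ x z y, P x z y ≤ 2 * K * (‖x‖ ^ 2 + ‖y‖ ^ 2) - z y := by
    intro x z y
    have h1 := norm_add_le x y
    have h2 := norm_sub_le x y
    have h3 : ‖x + y‖ ^ 2 ≤ 2 * (‖x‖ ^ 2 + ‖y‖ ^ 2) := by
      nlinarith [sq_nonneg (‖x‖ - ‖y‖), norm_nonneg (x + y)]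
    have h4 : ‖x - y‖ ^ 2 ≤ 2 * (‖x‖ ^ 2 + ‖y‖ ^ 2) := by
      nlinarith [sq_nonneg (‖x‖ - ‖y‖), norm_nonneg (x - y)]
    simp only [hP]
    linarith [hG2 (x + y), hG2 (x - y), mul_le_mul_of_nonneg_left h3 hK.le,
      mul_le_mul_of_nonneg_left h4 hK.le]
  refine ⟨fun x z => ⨅ y, P x z y, fun x => ?_, fun x z => ?_, fun x z d σ hσ => ?_⟩
  · refine le_ciInf fun y => le_trans ?_ (hPlow x 0 y)
    simp only [zero_apply, sub_zero]
    positivity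
  · set A := 2 * K * ‖x‖ ^ 2 - ⨅ y, P x z y with hA
    have hzy : ∀ y, z y ≤ A + 2 * K * ‖y‖ ^ 2 := fun y => by
      linarith [ciInf_le (hbdd x z) y, hPup x z y]
    have hA0 : 0 ≤ A := by simpa using hzy 0
    -- Replacing `y` by `t • y` gives a quadratic in `t` that is nowhere negative, so its
    -- discriminant is at most `0`.
    have hsq : ∀ y, (z y) ^ 2 ≤ 8 * K * A * ‖y‖ ^ 2 := by
      intro y
      have := discrim_le_zero (a := 2 * K * ‖y‖ ^ 2) (b := -z y) (c := A) fun t => by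
        have h := hzy (t • y)
        rw [map_smul, smul_eq_mul, norm_smul, mul_pow, Real.norm_eq_abs, sq_abs] at h
        linarith
      rw [discrim] at this
      linarith
    have hz : ‖z‖ ≤ √(8 * K * A) := by
      refine z.opNorm_le_bound (Real.sqrt_nonneg _) fun y => ?_
      refine Real.le_sqrt_of_sq_le ?_ |>.trans_eq (b := √(8 * K * A * ‖y‖ ^ 2)) ?_
      · rw [Real.norm_eq_abs, sq_abs]; exact hsq y
      · rw [Real.sqrt_mul (by positivity), Real.sqrt_sq (norm_nonneg y)]
    have hz2 : ‖z‖ ^ 2 ≤ 8 * K * A := 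
      (pow_le_pow_left₀ (norm_nonneg z) hz 2).trans_eq (Real.sq_sqrt (by positivity))
    have : (8 * K)⁻¹ * ‖z‖ ^ 2 ≤ A := by
      rwa [inv_mul_le_iff₀ (by positivity)]
    linarith
  · have key : ∀ y₁ y₂, ⨅ y, P x z y ≤
        (P (x + d) (z + σ • T d) y₁ + P (x - d) (z - σ • T d) y₂) / 2 := by
      intro y₁ y₂
      -- In these coordinates the four values of `G` form two midpoint gaps, at `x + y` with step `d
      -- + e` and at `x - y` with step `d - e`. By polarization their gain `|q (d + e)| + |q (d -
      -- e)|` covers the cross term `4 σ T d e`.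
      obtain ⟨y, e, rfl, rfl⟩ : ∃ y e, y₁ = y + e ∧ y₂ = y - e :=
        ⟨(1 / 2 : ℝ) • (y₁ + y₂), (1 / 2 : ℝ) • (y₁ - y₂), by module, by module⟩
      refine (ciInf_le (hbdd x z) y).trans ?_
      have h1 := hG (x + y) (d + e)
      have h2 := hG (x - y) (d - e)
      beta_reduce at h1 h2
      rw [IsSymmetricToDual.apply_add hT] at h1
      rw [IsSymmetricToDual.apply_sub hT] at h2
      have hle : 4 * (σ * T d e) ≤ |T d d + 2 * T d e + T e e| + |T d d - 2 * T d e + T e e| := by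
        rcases hσ with rfl | rfl
        · linarith [le_abs_self (T d d + 2 * T d e + T e e),
            neg_abs_le (T d d - 2 * T d e + T e e)]
        · linarith [neg_abs_le (T d d + 2 * T d e + T e e),
            le_abs_self (T d d - 2 * T d e + T e e)]
      simp only [hP, add_apply, sub_apply, smul_apply, smul_eq_mul, map_add, map_sub]
      rw [show x + d + (y + e) = x + y + (d + e) by abel,
        show x + d - (y + e) = x - y + (d - e) by abel,
        show x - d + (y - e) = x + y - (d + e) by abel,
        show x - d - (y - e) = x - y - (d - e) by abel]
      linarith
    have h2 : ∀ y₁, 2 * (⨅ y, P x z y) - P (x + d) (z + σ • T d) y₁ ≤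
        ⨅ y, P (x - d) (z - σ • T d) y := fun y₁ =>
      le_ciInf fun y₂ => by linarith [key y₁ y₂]
    have h3 : 2 * (⨅ y, P x z y) - (⨅ y, P (x - d) (z - σ • T d) y) ≤
        ⨅ y, P (x + d) (z + σ • T d) y :=
      le_ciInf fun y₁ => by linarith [h2 y₁]
    simp only
    linarith

end ControlToUMD

/-! ### Martingale transforms and the two implications. -/

section Main

/-- A function that is midpoint convex along the steps of a martingale transform is at most its
expected value along the transform. -/
theorem IsWalshPaleyMartingale.le_signExpectation {X Y : Type*} [NormedAddCommGroup X]
    [NormedSpace ℝ X] [NormedAddCommGroup Y] [NormedSpace ℝ Y] {T : X →L[ℝ] Y}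
    {H : X → Y → ℝ} (hH : ∀ x z d, ∀ σ : ℝ, (σ = 1 ∨ σ = -1) →
      H x z ≤ (H (x + d) (z + σ • T d) + H (x - d) (z - σ • T d)) / 2)
    {n : ℕ} {f : Fin (n + 1) → SignCube n → X} (hf : IsWalshPaleyMartingale f)
    {ε : Fin n → ℝ} (hε : ∀ k, ε k = 1 ∨ ε k = -1) :
    signExpectation (fun η => H (f 0 η) 0) ≤
      signExpectation fun η => H (f (Fin.last n) η)
        (∑ k : Fin n, ε k • T (f k.succ η - f k.castSucc η)) := by
  set S : Fin (n + 1) → SignCube n → Y := fun k η =>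
    ∑ i : Fin n, if (i : ℕ) < (k : ℕ) then ε i • T (f i.succ η - f i.castSucc η) else 0 with hS
  have hstep : ∀ (k : Fin n) η, S k.succ η =
      S k.castSucc η + ε k • T (f k.succ η - f k.castSucc η) := by
    intro k η
    have : ε k • T (f k.succ η - f k.castSucc η) =
        ∑ i : Fin n, if i = k then ε i • T (f i.succ η - f i.castSucc η) else 0 := by simp
    rw [this]
    simp only [hS, Fin.val_succ, Fin.val_castSucc, ← Finset.sum_add_distrib]
    refine Finset.sum_congr rfl fun i _ => ?_
    rcases lt_trichotomy i k with h | rfl | h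
    · rw [if_pos (by omega), if_pos (by omega), if_neg h.ne, add_zero]
    · simp
    · rw [if_neg (by omega), if_neg (by omega), if_neg h.ne', add_zero]
  have hadapt : ∀ (k : Fin (n + 1)) (ω ω' : SignCube n),
      (∀ i : Fin n, (i : ℕ) < (k : ℕ) → ω i = ω' i) → S k ω = S k ω' := by
    intro k ω ω' h
    refine Finset.sum_congr rfl fun i _ => ?_
    split_ifs with hi
    · rw [hf.adapted i.succ ω ω' fun j hj => h j (by simp at hj; omega),
        hf.adapted i.castSucc ω ω' fun j hj => h j (by simp at hj; omega)]
    · rfl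
  have hmono : ∀ k : Fin n, signExpectation (fun η => H (f k.castSucc η) (S k.castSucc η)) ≤
      signExpectation fun η => H (f k.succ η) (S k.succ η) := by
    intro k
    rw [← signExpectation_update k fun η => H (f k.succ η) (S k.succ η)]
    refine signExpectation_mono fun ω => ?_
    -- Time `k` does not see the sign `ω k`; its two values give opposite increments, so `hH`
    -- applies pointwise.
    have hω : ∀ (u : ℤˣ) (i : Fin n), (i : ℕ) < (k.castSucc : ℕ) →
        Function.update ω k u i = ω i := fun u i hi =>
      Function.update_of_ne (by rintro rfl; simp at hi) _ _
    have hfu := fun u => hf.adapted k.castSucc _ _ (hω u)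
    have hSu := fun u => hadapt k.castSucc _ _ (hω u)
    have hav := hf.average k ω
    set p := f k.succ (Function.update ω k 1) with hp
    set m := f k.succ (Function.update ω k (-1)) with hm
    have hpx : p = f k.castSucc ω + (p - f k.castSucc ω) := by abel
    have hmx : m = f k.castSucc ω - (p - f k.castSucc ω) := by rw [hav]; module
    have hmd : m - f k.castSucc ω = -(p - f k.castSucc ω) := by rw [hav]; module
    rw [hstep, hstep, hfu, hSu, hfu, hSu, ← hp, ← hm, hmd, map_neg, smul_neg, ← sub_eq_add_neg]
    have h := hH (f k.castSucc ω) (S k.castSucc ω) (p - f k.castSucc ω) (ε k) (hε k)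
    rw [← hpx, ← hmx] at h
    linarith
  have hall : ∀ k : Fin (n + 1), signExpectation (fun η => H (f 0 η) 0) ≤
      signExpectation fun η => H (f k η) (S k η) := by
    intro k
    induction k using Fin.induction with
    | zero => simp [hS]
    | succ k ih => exact ih.trans (hmono k)
  simpa [hS] using hall (Fin.last n)

variable {X : Type*} [NormedAddCommGroup X] [NormedSpace ℝ X]

theorem IsDeltaConvex.isUMDOperator {T : X →L[ℝ] StrongDual ℝ X} (hT : IsSymmetricToDual T)
    (h : IsDeltaConvex fun x => T x x) : IsUMDOperator T := by
  obtain ⟨F, M, hF, hF0, hFM⟩ := h.exists_controls hT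
  obtain ⟨G, K, hK, hG1, hG2, hG⟩ := hF.exists_quadratic_growth hF0 hFM
  obtain ⟨H, hH0, hHle, hH⟩ := hG.exists_bellman hT hK hG1 hG2
  -- `16 * K ^ 2` is `2 K` divided by `(8 K)⁻¹`, the two coefficients in the upper bound for `H`.
  refine ⟨16 * K ^ 2, by positivity, fun n f hf ε hε => ?_⟩
  have h0 : 0 ≤ signExpectation fun η => H (f 0 η) 0 := by
    rw [← signExpectation_const (n := n) 0]
    exact signExpectation_mono fun η => hH0 _
  have h1 := h0.trans ((hf.le_signExpectation hH hε).trans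
    (signExpectation_mono fun η => hHle _ _))
  rw [signExpectation_sub, signExpectation_const_mul, signExpectation_const_mul, sub_nonneg,
    inv_mul_le_iff₀ (by positivity)] at h1
  linarith

theorem IsUMDOperator.isDeltaConvex {T : X →L[ℝ] StrongDual ℝ X} (hT : IsSymmetricToDual T)
    (h : IsUMDOperator T) : IsDeltaConvex fun x => T x x := by
  obtain ⟨F, K, hK, hF⟩ := h.exists_controls
  exact hF.isDeltaConvex hT hK

theorem IsContinuousQuadraticForm.exists_symmetric {q : X → ℝ}
    (hq : IsContinuousQuadraticForm q) :
    ∃ T : X →L[ℝ] StrongDual ℝ X, IsSymmetricToDual T ∧ q = fun x => T x x := by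
  obtain ⟨b, hb⟩ := hq
  refine ⟨(1 / 2 : ℝ) • (b + b.flip), fun x y => ?_, funext fun x => ?_⟩
  · simp [add_comm]
  · rw [hb]
    simp only [smul_apply, add_apply, ContinuousLinearMap.flip_apply, smul_eq_mul]
    ring

theorem IsUMDSpace.isUMDOperator {Y : Type*} [NormedAddCommGroup Y] [NormedSpace ℝ Y]
    (h : IsUMDSpace X) (T : X →L[ℝ] Y) : IsUMDOperator T := by
  obtain ⟨C, hC, H⟩ := h
  -- The `+ 1` keeps the constant positive when `T = 0`.
  refine ⟨(‖T‖ ^ 2 + 1) * C, by positivity, fun n f hf ε hε => ?_⟩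
  have hE : 0 ≤ signExpectation fun η => ‖f (Fin.last n) η‖ ^ 2 := by
    rw [← signExpectation_const (n := n) 0]
    exact signExpectation_mono fun η => by positivity
  have h1 : signExpectation (fun η => ‖∑ k : Fin n, ε k • T (f k.succ η - f k.castSucc η)‖ ^ 2) ≤
      signExpectation fun η => ‖T‖ ^ 2 * ‖∑ k : Fin n, ε k •
        ContinuousLinearMap.id ℝ X (f k.succ η - f k.castSucc η)‖ ^ 2 := by
    refine signExpectation_mono fun η => ?_
    rw [← mul_pow]
    refine pow_le_pow_left₀ (norm_nonneg _) ?_ 2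
    refine le_trans (le_of_eq ?_) (T.le_opNorm _)
    simp only [map_sum, map_smul, ContinuousLinearMap.id_apply]
  rw [signExpectation_const_mul] at h1
  have h2 := mul_le_mul_of_nonneg_left (H n f hf ε hε) (sq_nonneg ‖T‖)
  have := mul_nonneg hC.le hE
  linarith

end Main

theorem theorem2p8 (X : Type*) [NormedAddCommGroup X] [NormedSpace ℝ X] [CompleteSpace X] :
    ((∀ q : X → ℝ, IsContinuousQuadraticForm q → IsDeltaConvex q) ↔
      ∀ T : X →L[ℝ] StrongDual ℝ X, IsSymmetricToDual T → IsUMDOperator T) ∧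
    (IsUMDSpace X → ∀ q : X → ℝ, IsContinuousQuadraticForm q → IsDeltaConvex q) := by
  refine ⟨⟨fun h T hT => (h _ ⟨T, fun _ => rfl⟩).isUMDOperator hT, fun h q hq => ?_⟩,
    fun h q hq => ?_⟩
  · obtain ⟨T, hT, rfl⟩ := hq.exists_symmetric
    exact (h T hT).isDeltaConvex hT
  · obtain ⟨T, hT, rfl⟩ := hq.exists_symmetric
    exact (h.isUMDOperator T).isDeltaConvex hT
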